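/- For integers $k\ge 2$ and $s,n\ge 1$, let $r_k(s,n)$ denote the least positive integer $N$ such that every red/blue coloring of the edges of the complete $k$-uniform hypergraph on $N$ vertices (that is, of the $k$-element subsets of its vertex set) contains a set of $s$ vertices all of whose $k$-element subsets are red, or a set of $n$ vertices all of whose $k$-element subsets are blue. Define the tower function by $\mathrm{twr}_1(x)=x$ and $\mathrm{twr}_{i+1}(x)=2^{\mathrm{twr}_i(x)}$ for $i\ge 1$. All logarithms are to base $2$. **Theorem.** There is an absolute constant $c>0$ such that, for all sufficiently large $n$, $$r_4(5,n) > 2^{n^{c\log\log n}},$$ and, more generally, for every $k>4$ and all $n$ sufficiently large in terms of $k$, $$r_k(k+1,n) > \mathrm{twr}_{k-2}\bigl(n^{c\log\log n}\bigr),$$ where the constant $c$ does not depend on $k$ or $n$. -/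

import Mathlib

/-- A red/blue coloring of the edges of the complete `k`-uniform hypergraph on the vertex set
`Fin N`; the edges are the `k`-element sets of vertices, `true` is red and `false` is blue. -/
abbrev EdgeColoring (k N : ℕ) : Type := {e : Finset (Fin N) // e.card = k} → Bool

/-- All edges contained in the vertex set `S` have color `b`; when `S` has `m` elements, `S` spans
a copy of the complete `k`-uniform hypergraph on `m` vertices, all of whose edges have color `b`. -/
def EdgeColoring.IsMonochromatic {k N : ℕ} (χ : EdgeColoring k N) (b : Bool)
    (S : Finset (Fin N)) : Prop :=
  ∀ e : {e : Finset (Fin N) // e.card = k}, e.1 ⊆ S → χ e = b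

/-- The Ramsey number `r_k(s, n)`: the least `N` such that every red/blue coloring of the edges of
the complete `k`-uniform hypergraph on `N` vertices contains a red complete `k`-uniform hypergraph
on `s` vertices or a blue complete `k`-uniform hypergraph on `n` vertices. -/
noncomputable def hypergraphRamsey (k s n : ℕ) : ℕ :=
  sInf {N : ℕ | ∀ χ : EdgeColoring k N,
    (∃ S : Finset (Fin N), S.card = s ∧ χ.IsMonochromatic true S) ∨
    (∃ S : Finset (Fin N), S.card = n ∧ χ.IsMonochromatic false S)}

/-- The tower function: `twr 1 x = x` and `twr (i + 1) x = 2 ^ twr i x` for `i ≥ 1`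
(the value at index `0` is a convention that is never used). -/
noncomputable def twr : ℕ → ℝ → ℝ
  | 0, x => x
  | 1, x => x
  | i + 2, x => (2 : ℝ) ^ twr (i + 1) x

/-! The bound starts from a 3-uniform coloring with no red 4-set and no blue `n`-set on about 2^(c n
log n) vertices, and then steps up in uniformity. Let `F` have odd order q. The digraph on `F × F`
with arcs x → x + (t, t²), t ≠ 0, has no transitive triangle, yet a second-moment count finds an arc
from A to B as soon as both sets are a little larger than q^(3/2) (`card_mul_card_le_of_no_arc`).
Label pairs randomly by points of the plane and make a < b < c red if the label of ab sends an arc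
to that of ac. A red 4-set would give a transitive triangle; in a large set some vertex sees many
labels on two later blocks, which forces a red triple.

Stepping up (`AvoidsCliques.stepUp`) passes from M to 2^M vertices, reading off the leading digits
in which consecutive vertices differ. From uniformity 3 to 4, n becomes 2^(2n), so that n log n
turns into the exponent n^(c log log n). From uniformity 4 on, edges are long enough for a zigzag
pattern to be declared red, and the cost is only n ↦ 3n + k + 1. Each step adds one exponential to
the tower. -/

/-- There is a red/blue coloring of the `k`-sets of `{0, …, N - 1}` (the red ones are those
satisfying `R`) without a red complete hypergraph on `s` vertices and without a blue one on `n`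
vertices. -/
def AvoidsCliques (k s n N : ℕ) : Prop :=
  ∃ R : Finset ℕ → Prop,
    (∀ S ⊆ Finset.range N, S.card = s → ∃ e ⊆ S, e.card = k ∧ ¬ R e) ∧
    (∀ S ⊆ Finset.range N, S.card = n → ∃ e ⊆ S, e.card = k ∧ R e)

theorem AvoidsCliques.mono {k s n n' N : ℕ} (h : AvoidsCliques k s n N) (hn : n ≤ n') :
    AvoidsCliques k s n' N := by
  obtain ⟨R, h₁, h₂⟩ := h
  refine ⟨R, h₁, fun S hS hc => ?_⟩
  obtain ⟨T, hT, hTc⟩ := Finset.exists_subset_card_eq (hc ▸ hn : n ≤ S.card)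
  obtain ⟨e, he, h⟩ := h₂ T (hT.trans hS) hTc
  exact ⟨e, he.trans hT, h⟩

/-! ### Ramsey's theorem and lower bounds from colorings -/

/-- Ramsey's theorem for two colors and finite sets of natural numbers. -/
theorem exists_ramsey_finset (k s n : ℕ) : ∃ N : ℕ, ∀ S : Finset ℕ, N ≤ S.card →
    ∀ R : Finset ℕ → Prop,
      (∃ T ⊆ S, T.card = s ∧ ∀ e ⊆ T, e.card = k → R e) ∨
      (∃ T ⊆ S, T.card = n ∧ ∀ e ⊆ T, e.card = k → ¬ R e) := by
  induction k generalizing s n with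
  | zero =>
    refine ⟨max s n, fun S hS R => ?_⟩
    by_cases hR : R ∅
    · obtain ⟨T, hT, hc⟩ := Finset.exists_subset_card_eq ((le_max_left s n).trans hS)
      exact Or.inl ⟨T, hT, hc, fun e _ h => by rwa [Finset.card_eq_zero.1 h]⟩
    · obtain ⟨T, hT, hc⟩ := Finset.exists_subset_card_eq ((le_max_right s n).trans hS)
      exact Or.inr ⟨T, hT, hc, fun e _ h => by rwa [Finset.card_eq_zero.1 h]⟩
  | succ k ihk =>
    obtain ⟨m, hm⟩ : ∃ m, m = s + n := ⟨_, rfl⟩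
    induction m generalizing s n with
    | zero =>
      refine ⟨0, fun S _ R => Or.inl ⟨∅, by simp, by simp; omega, fun e he hc => ?_⟩⟩
      simp [Finset.subset_empty.1 he] at hc
    | succ m ihm =>
      rcases s with _ | s
      · refine ⟨0, fun S _ R => Or.inl ⟨∅, by simp, by simp, fun e he hc => ?_⟩⟩
        simp [Finset.subset_empty.1 he] at hc
      rcases n with _ | n
      · refine ⟨0, fun S _ R => Or.inr ⟨∅, by simp, by simp, fun e he hc => ?_⟩⟩
        simp [Finset.subset_empty.1 he] at hc
      obtain ⟨N₁, h₁⟩ := ihm s (n + 1) (by omega)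
      obtain ⟨N₂, h₂⟩ := ihm (s + 1) n (by omega)
      -- Color k-sets by adjoining a fixed vertex `x`. A monochromatic set for this coloring is
      -- large enough to apply the bound with one of `s`, `n` lowered, and `x` restores the lost
      -- vertex.
      obtain ⟨N, hN⟩ := ihk N₁ N₂
      refine ⟨N + 1, fun S hS R => ?_⟩
      obtain ⟨x, hx⟩ : S.Nonempty := Finset.card_pos.1 (by omega)
      have key : ∀ (T : Finset ℕ) (Q : Finset ℕ → Prop), x ∉ T →
          (∀ e ⊆ T, e.card = k → Q (insert x e)) → (∀ e ⊆ T, e.card = k + 1 → Q e) →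
          ∀ e ⊆ insert x T, e.card = k + 1 → Q e := by
        intro T Q hxT hl ht e he hc
        by_cases hxe : x ∈ e
        · rw [← Finset.insert_erase hxe]
          refine hl _ (Finset.subset_insert_iff.1 he) ?_
          rw [Finset.card_erase_of_mem hxe, hc, Nat.add_sub_cancel]
        · exact ht e ((Finset.subset_insert_iff_of_notMem hxe).1 he) hc
      rcases hN (S.erase x) (by rw [Finset.card_erase_of_mem hx]; omega)
          (fun e => R (insert x e)) with ⟨T, hT, hTc, hTR⟩ | ⟨T, hT, hTc, hTR⟩
      · have hxT : x ∉ T := fun h => by simpa using hT h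
        have hTS : T ⊆ S := hT.trans (Finset.erase_subset _ _)
        rcases h₁ T hTc.ge R with ⟨U, hU, hUc, hUR⟩ | ⟨U, hU, hUc, hUR⟩
        · have hxU : x ∉ U := fun h => hxT (hU h)
          refine Or.inl ⟨insert x U, Finset.insert_subset hx (hU.trans hTS), ?_, ?_⟩
          · rw [Finset.card_insert_of_notMem hxU, hUc]
          · exact key U R hxU (fun e he hc => hTR e (he.trans hU) hc) hUR
        · exact Or.inr ⟨U, hU.trans hTS, hUc, hUR⟩
      · have hxT : x ∉ T := fun h => by simpa using hT h
        have hTS : T ⊆ S := hT.trans (Finset.erase_subset _ _)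
        rcases h₂ T hTc.ge R with ⟨U, hU, hUc, hUR⟩ | ⟨U, hU, hUc, hUR⟩
        · exact Or.inl ⟨U, hU.trans hTS, hUc, hUR⟩
        · have hxU : x ∉ U := fun h => hxT (hU h)
          refine Or.inr ⟨insert x U, Finset.insert_subset hx (hU.trans hTS), ?_, ?_⟩
          · rw [Finset.card_insert_of_notMem hxU, hUc]
          · exact key U (fun e => ¬ R e) hxU (fun e he hc => hTR e (he.trans hU) hc) hUR

/-- Ramsey's theorem in the form needed for `hypergraphRamsey` to be a true minimum. -/
theorem hypergraphRamsey_mem (k s n : ℕ) :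
    hypergraphRamsey k s n ∈ {N : ℕ | ∀ χ : EdgeColoring k N,
      (∃ S : Finset (Fin N), S.card = s ∧ χ.IsMonochromatic true S) ∨
      (∃ S : Finset (Fin N), S.card = n ∧ χ.IsMonochromatic false S)} := by
  refine Nat.sInf_mem ?_
  obtain ⟨N, hN⟩ := exists_ramsey_finset k s n
  refine ⟨N, fun χ => ?_⟩
  have pull : ∀ T ⊆ Finset.range N,
      ∃ S : Finset (Fin N), S.map Fin.valEmbedding = T := by
    intro T hT
    refine ⟨Finset.univ.filter fun i => (i : ℕ) ∈ T, ?_⟩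
    ext i
    simp only [Finset.mem_map, Finset.mem_filter, Finset.mem_univ, true_and,
      Fin.valEmbedding_apply]
    exact ⟨fun ⟨a, ha, h⟩ => h ▸ ha, fun h => ⟨⟨i, Finset.mem_range.1 (hT h)⟩, h, rfl⟩⟩
  rcases hN (Finset.range N) (by simp)
    (fun e => ∃ f : {e : Finset (Fin N) // e.card = k}, f.1.map Fin.valEmbedding = e ∧
      χ f = true) with ⟨T, hT, hTc, h⟩ | ⟨T, hT, hTc, h⟩
  · obtain ⟨S, rfl⟩ := pull T hT
    refine Or.inl ⟨S, by simpa using hTc, fun e he => ?_⟩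
    obtain ⟨f, hf, hχ⟩ := h (e.1.map Fin.valEmbedding) (Finset.map_subset_map.2 he)
      (by simp [e.2])
    rwa [← Subtype.ext (Finset.map_injective _ hf)]
  · obtain ⟨S, rfl⟩ := pull T hT
    refine Or.inr ⟨S, by simpa using hTc, fun e he => ?_⟩
    have := h (e.1.map Fin.valEmbedding) (Finset.map_subset_map.2 he) (by simp [e.2])
    push Not at this
    simpa using this e rfl

/-- A good coloring on `N` vertices restricts to any smaller number of vertices, so the minimum
cannot be at most `N`. -/
theorem AvoidsCliques.lt_hypergraphRamsey {k s n N : ℕ} (h : AvoidsCliques k s n N) :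
    N < hypergraphRamsey k s n := by
  classical
  by_contra! hle
  obtain ⟨R, h₁, h₂⟩ := h
  have hsub : ∀ S : Finset (Fin (hypergraphRamsey k s n)),
      S.map Fin.valEmbedding ⊆ Finset.range N := by
    intro S i hi
    obtain ⟨a, -, rfl⟩ := Finset.mem_map.1 hi
    exact Finset.mem_range.2 (a.2.trans_le hle)
  have pull : ∀ (S : Finset (Fin (hypergraphRamsey k s n))) (e : Finset ℕ),
      e ⊆ S.map Fin.valEmbedding → ∃ f ⊆ S, e = f.map Fin.valEmbedding := by
    intro S e he
    exact Finset.subset_map_iff.1 he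
  rcases hypergraphRamsey_mem k s n (fun e => decide (R (e.1.map Fin.valEmbedding))) with
    ⟨S, hS, hm⟩ | ⟨S, hS, hm⟩
  · obtain ⟨e, he, hc, hR⟩ := h₁ _ (hsub S) (by simpa using hS)
    obtain ⟨f, hf, rfl⟩ := pull S e he
    exact hR (by simpa using hm ⟨f, by simpa using hc⟩ hf)
  · obtain ⟨e, he, hc, hR⟩ := h₂ _ (hsub S) (by simpa using hS)
    obtain ⟨f, hf, rfl⟩ := pull S e he
    have := hm ⟨f, by simpa using hc⟩ hf
    simp only [decide_eq_false_iff_not] at this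
    exact this hR

/-! ### Leading differing digits -/

/-- The position of the leading binary digit in which `x` and `y` differ. -/
noncomputable def leadingDiff (x y : ℕ) : ℕ := sInf {d : ℕ | x / 2 ^ (d + 1) = y / 2 ^ (d + 1)}

theorem div_eq_div_of_le {x y a b : ℕ} (h : a ≤ b) (hxy : x / 2 ^ a = y / 2 ^ a) :
    x / 2 ^ b = y / 2 ^ b := by
  obtain ⟨c, rfl⟩ := Nat.exists_eq_add_of_le h
  rw [pow_add, ← Nat.div_div_eq_div_mul, ← Nat.div_div_eq_div_mul, hxy]

theorem leadingDiff_le_iff {x y d : ℕ} :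
    leadingDiff x y ≤ d ↔ x / 2 ^ (d + 1) = y / 2 ^ (d + 1) := by
  refine ⟨fun h => ?_, fun h => Nat.sInf_le h⟩
  have hne : {d : ℕ | x / 2 ^ (d + 1) = y / 2 ^ (d + 1)}.Nonempty := by
    refine ⟨x + y, ?_⟩
    have h : x + y < 2 ^ (x + y + 1) :=
      Nat.lt_two_pow_self.trans (Nat.pow_lt_pow_right (by norm_num) (Nat.lt_succ_self _))
    rw [Set.mem_ofPred_eq, Nat.div_eq_of_lt (by omega), Nat.div_eq_of_lt (by omega)]
  exact div_eq_div_of_le (Nat.succ_le_succ h) (Nat.sInf_mem hne)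

theorem leadingDiff_eq {x y d : ℕ} (h : x / 2 ^ d ≠ y / 2 ^ d)
    (h' : x / 2 ^ (d + 1) = y / 2 ^ (d + 1)) : leadingDiff x y = d := by
  refine le_antisymm (leadingDiff_le_iff.2 h') ?_
  by_contra! hlt
  exact h (div_eq_div_of_le hlt (leadingDiff_le_iff.1 le_rfl))

theorem div_ne_div_leadingDiff {x y : ℕ} (h : x ≠ y) :
    x / 2 ^ leadingDiff x y ≠ y / 2 ^ leadingDiff x y := by
  rcases hd : leadingDiff x y with _ | d
  · simpa using h
  · intro he
    have := leadingDiff_le_iff.2 he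
    omega

theorem leadingDiff_lt {x y M : ℕ} (hM : 0 < M) (hx : x < 2 ^ M) (hy : y < 2 ^ M) :
    leadingDiff x y < M := by
  obtain ⟨m, rfl⟩ := Nat.exists_eq_add_of_le' hM
  rw [Nat.lt_succ_iff, leadingDiff_le_iff, Nat.div_eq_of_lt hx, Nat.div_eq_of_lt hy]

/-- Quotients by a power of 2 are monotone, so the outer two agree exactly when both agree with the
middle one. -/
theorem leadingDiff_max {x y z : ℕ} (hxy : x < y) (hyz : y < z) :
    leadingDiff x z = max (leadingDiff x y) (leadingDiff y z) := by
  refine eq_of_forall_ge_iff fun d => ?_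
  rw [max_le_iff, leadingDiff_le_iff, leadingDiff_le_iff, leadingDiff_le_iff]
  have h₁ := Nat.div_le_div_right (c := 2 ^ (d + 1)) hxy.le
  have h₂ := Nat.div_le_div_right (c := 2 ^ (d + 1)) hyz.le
  omega

/-- At the leading differing digit the smaller number has 0 and the larger has 1; `y` cannot have
both at one position. -/
theorem leadingDiff_ne {x y z : ℕ} (hxy : x < y) (hyz : y < z) :
    leadingDiff x y ≠ leadingDiff y z := by
  intro h
  have h₁ := div_ne_div_leadingDiff hxy.ne
  have h₂ := div_ne_div_leadingDiff hyz.ne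
  have h₃ := leadingDiff_le_iff.1 (le_refl (leadingDiff x y))
  have h₄ := leadingDiff_le_iff.1 (le_refl (leadingDiff y z))
  rw [← h] at h₂ h₄
  have h₅ := Nat.div_le_div_right (c := 2 ^ leadingDiff x y) hxy.le
  have h₆ := Nat.div_le_div_right (c := 2 ^ leadingDiff x y) hyz.le
  rw [pow_succ, ← Nat.div_div_eq_div_mul, ← Nat.div_div_eq_div_mul] at h₃ h₄
  omega

/-- The leading differing digit of two consecutive terms of a sequence. -/
noncomputable def stepDiff (w : ℕ → ℕ) (i : ℕ) : ℕ := leadingDiff (w i) (w (i + 1))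

/-- `w 0 < ⋯ < w m`. -/
def IsAscending (m : ℕ) (w : ℕ → ℕ) : Prop := ∀ i < m, w i < w (i + 1)

/-- The `stepDiff`s of `w 0, …, w m` increase. -/
def StepsUp (m : ℕ) (w : ℕ → ℕ) : Prop := ∀ i, i + 1 < m → stepDiff w i < stepDiff w (i + 1)

/-- The `stepDiff`s of `w 0, …, w m` decrease. -/
def StepsDown (m : ℕ) (w : ℕ → ℕ) : Prop := ∀ i, i + 1 < m → stepDiff w (i + 1) < stepDiff w i

theorem lt_of_lt_succ_of_lt {f : ℕ → ℕ} {m : ℕ} (h : ∀ i < m, f i < f (i + 1)) {i j : ℕ}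
    (hij : i < j) (hj : j ≤ m) : f i < f j := by
  induction j, hij using Nat.le_induction with
  | base => exact h _ (by omega)
  | succ j hij ih => exact (ih (by omega)).trans (h _ (by omega))

theorem lt_of_succ_lt_of_lt {f : ℕ → ℕ} {m : ℕ} (h : ∀ i < m, f (i + 1) < f i) {i j : ℕ}
    (hij : i < j) (hj : j ≤ m) : f j < f i := by
  induction j, hij using Nat.le_induction with
  | base => exact h _ (by omega)
  | succ j hij ih => exact (h _ (by omega)).trans (ih (by omega))

theorem IsAscending.lt {m : ℕ} {w : ℕ → ℕ} (h : IsAscending m w) {i j : ℕ} (hij : i < j) (hj : j ≤ m) :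
    w i < w j := lt_of_lt_succ_of_lt h hij hj

theorem IsAscending.shift {m : ℕ} {w : ℕ → ℕ} (h : IsAscending m w) {a b : ℕ} (hab : a + b ≤ m) :
    IsAscending b fun i => w (a + i) := fun i hi => h (a + i) (by omega)

theorem StepsUp.lt {m : ℕ} {w : ℕ → ℕ} (h : StepsUp m w) {i j : ℕ} (hij : i < j) (hj : j < m) :
    stepDiff w i < stepDiff w j :=
  lt_of_lt_succ_of_lt (m := m - 1) (fun i hi => h i (by omega)) hij (by omega)

theorem StepsDown.lt {m : ℕ} {w : ℕ → ℕ} (h : StepsDown m w) {i j : ℕ} (hij : i < j)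
    (hj : j < m) : stepDiff w j < stepDiff w i :=
  lt_of_succ_lt_of_lt (m := m - 1) (fun i hi => h i (by omega)) hij (by omega)

theorem leadingDiff_chain_last {m : ℕ} {w : ℕ → ℕ} (hw : IsAscending m w) {a b : ℕ} (hab : a ≤ b)
    (hb : b < m) (h : ∀ i, a ≤ i → i < b → stepDiff w i < stepDiff w (i + 1)) :
    leadingDiff (w a) (w (b + 1)) = stepDiff w b := by
  induction b, hab using Nat.le_induction with
  | base => rfl
  | succ b hab ih =>
    rw [leadingDiff_max (hw.lt (j := b + 1) (by omega) (by omega)) (hw _ hb),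
      ih (by omega) fun i hi hib => h i hi (by omega)]
    exact max_eq_right (h b hab (by omega)).le

theorem leadingDiff_chain_first {m : ℕ} {w : ℕ → ℕ} (hw : IsAscending m w) {a b : ℕ} (hab : a ≤ b)
    (hb : b < m) (h : ∀ i, a ≤ i → i < b → stepDiff w (i + 1) < stepDiff w i) :
    leadingDiff (w a) (w (b + 1)) = stepDiff w a := by
  have hle : ∀ i, a ≤ i → i ≤ b → stepDiff w i ≤ stepDiff w a := by
    intro i hai
    induction i, hai using Nat.le_induction with
    | base => exact fun _ => le_rfl
    | succ i hai ih => exact fun hib => (h i hai hib).le.trans (ih (by omega))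
  induction b, hab using Nat.le_induction with
  | base => rfl
  | succ b hab ih =>
    rw [leadingDiff_max (hw.lt (j := b + 1) (by omega) (by omega)) (hw _ hb),
      ih (by omega) (fun i hi hib => h i hi (by omega)) fun i hi hib => hle i hi (by omega)]
    exact max_eq_left (hle (b + 1) (by omega) le_rfl)

/-! ### Enumerating finite sets in ascending order -/

/-- The increasing enumeration of a finite set (with junk values beyond its size). -/
noncomputable def enum (S : Finset ℕ) : ℕ → ℕ := Nat.nth (· ∈ S)

theorem enum_isAscending {S : Finset ℕ} {m : ℕ} (h : S.card = m + 1) : IsAscending m (enum S) := by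
  intro i hi
  refine Nat.nth_lt_nth' (Nat.lt_succ_self i) fun hf => ?_
  have : hf.toFinset = S := by ext; simp
  rw [this]; omega

theorem enum_mem {S : Finset ℕ} {i : ℕ} (h : i < S.card) : enum S i ∈ S := by
  refine Nat.nth_mem i fun hf => ?_
  have : hf.toFinset = S := by ext; simp
  rwa [this]

theorem IsAscending.injOn {m : ℕ} {w : ℕ → ℕ} (hw : IsAscending m w) :
    Set.InjOn w (Finset.range (m + 1)) := by
  intro i hi j hj hij
  simp only [Finset.coe_range, Set.mem_Iio] at hi hj
  rcases lt_trichotomy i j with h | h | h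
  · have := hw.lt h (by omega); omega
  · exact h
  · have := hw.lt h (by omega); omega

theorem IsAscending.card_image {m : ℕ} {w : ℕ → ℕ} (hw : IsAscending m w) :
    ((Finset.range (m + 1)).image w).card = m + 1 := by
  rw [Finset.card_image_of_injOn hw.injOn, Finset.card_range]

theorem image_enum {S : Finset ℕ} {m : ℕ} (h : S.card = m + 1) :
    (Finset.range (m + 1)).image (enum S) = S := by
  refine Finset.eq_of_subset_of_card_le (fun x hx => ?_) ?_
  · obtain ⟨i, hi, rfl⟩ := Finset.mem_image.1 hx
    exact enum_mem (h ▸ Finset.mem_range.1 hi)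
  · rw [(enum_isAscending h).card_image, h]

theorem IsAscending.eq_enum {m : ℕ} {w : ℕ → ℕ} (hw : IsAscending m w) {i : ℕ} (hi : i ≤ m) :
    enum ((Finset.range (m + 1)).image w) i = w i := by
  set S := (Finset.range (m + 1)).image w with hS
  have key : ∀ u : ℕ → ℕ, IsAscending m u → (∀ i ≤ m, u i ∈ S) →
      (fun i : Fin (m + 1) => u i) = S.orderEmbOfFin hw.card_image := by
    intro u hu hm
    exact Finset.orderEmbOfFin_unique _ (fun i => hm i (by omega))
      fun i j hij => hu.lt hij (by omega)
  have h₁ := key _ (enum_isAscending hw.card_image) fun i hi =>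
    enum_mem (by rw [hw.card_image]; omega)
  have h₂ := key w hw fun i hi => Finset.mem_image_of_mem _ (Finset.mem_range.2 (by omega))
  exact congrFun (h₁.trans h₂.symm) ⟨i, by omega⟩

/-! ### The stepped-up coloring -/

/-- The stepped-up coloring: the set `{w 0 < ⋯ < w k}` is red if its `stepDiff`s are monotone and
form a red set for `R`, or if `P w` holds. -/
def stepUp (k : ℕ) (R : Finset ℕ → Prop) (P : (ℕ → ℕ) → Prop) (w : ℕ → ℕ) : Prop :=
  (StepsUp k w ∨ StepsDown k w) ∧ R ((Finset.range k).image (stepDiff w)) ∨ P w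

/-- The enumeration of a `k`-element subset of the `stepDiff`s of an ascending chain is the
sequence of `stepDiff`s of a subchain. -/
theorem exists_subchain_up {m k : ℕ} {w : ℕ → ℕ} (hw : IsAscending m w) (hup : StepsUp m w)
    {e : Finset ℕ} (he : e ⊆ (Finset.range m).image (stepDiff w)) (hk : e.card = k + 1) :
    ∃ u : ℕ → ℕ, IsAscending (k + 1) u ∧ StepsUp (k + 1) u ∧
      (∀ i ≤ k + 1, ∃ j ≤ m, u i = w j) ∧ (Finset.range (k + 1)).image (stepDiff u) = e := by
  set I := (Finset.range m).filter fun i => stepDiff w i ∈ e with hI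
  have himg : I.image (stepDiff w) = e := by
    ext y
    simp only [hI, Finset.mem_image, Finset.mem_filter]
    refine ⟨fun ⟨i, hi, h⟩ => h ▸ hi.2, fun hy => ?_⟩
    obtain ⟨i, hi, rfl⟩ := Finset.mem_image.1 (he hy)
    exact ⟨i, ⟨hi, hy⟩, rfl⟩
  have hIc : I.card = k + 1 := by
    rw [← hk, ← himg, Finset.card_image_of_injOn]
    intro i hi j hj hij
    simp only [hI, Finset.coe_filter, Finset.mem_range, Set.mem_ofPred_eq] at hi hj
    rcases lt_trichotomy i j with h | h | h
    · have := hup.lt h hj.1; omega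
    · exact h
    · have := hup.lt h hi.1; omega
  have hc := enum_isAscending hIc
  have hlt : ∀ i ≤ k, enum I i < m := fun i hi =>
    Finset.mem_range.1 (Finset.mem_filter.1 (enum_mem (S := I) (by omega))).1
  -- With rising steps, the leading difference of two vertices is the last step between them, so
  -- each chosen step contributes its right endpoint.
  let u : ℕ → ℕ := fun i => if i = 0 then w (enum I 0) else w (enum I (i - 1) + 1)
  have hstep : ∀ i ≤ k, stepDiff u i = stepDiff w (enum I i) := by
    intro i hi
    rcases i with _ | i
    · simp [u, stepDiff]
    · have h := leadingDiff_chain_last hw (hc i (by omega)) (hlt _ hi)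
        fun j _ hj => hup j (by have := hlt _ hi; omega)
      simpa [u, stepDiff] using h
  refine ⟨u, ?_, ?_, ?_, ?_⟩
  · intro i hi
    rcases i with _ | i
    · simpa [u] using hw _ (hlt 0 (by omega))
    · have h₁ := hc i (by omega)
      have h₂ := hlt (i + 1) (by omega)
      simpa [u] using hw.lt (i := enum I i + 1) (j := enum I (i + 1) + 1) (by omega) (by omega)
  · intro i hi
    rw [hstep i (by omega), hstep (i + 1) (by omega)]
    exact hup.lt (hc i (by omega)) (hlt _ (by omega))
  · intro i hi
    rcases i with _ | i
    · exact ⟨_, (hlt 0 (by omega)).le, by simp [u]⟩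
    · exact ⟨_, hlt i (by omega), by simp [u]⟩
  · rw [← himg, ← image_enum hIc, Finset.image_image]
    exact Finset.image_congr fun i hi => hstep i (by simpa [Nat.lt_succ_iff] using hi)

/-- The enumeration of a `k`-element subset of the `stepDiff`s of a descending chain is the
sequence of `stepDiff`s of a subchain. -/
theorem exists_subchain_down {m k : ℕ} {w : ℕ → ℕ} (hw : IsAscending m w) (hdn : StepsDown m w)
    {e : Finset ℕ} (he : e ⊆ (Finset.range m).image (stepDiff w)) (hk : e.card = k + 1) :
    ∃ u : ℕ → ℕ, IsAscending (k + 1) u ∧ StepsDown (k + 1) u ∧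
      (∀ i ≤ k + 1, ∃ j ≤ m, u i = w j) ∧ (Finset.range (k + 1)).image (stepDiff u) = e := by
  set I := (Finset.range m).filter fun i => stepDiff w i ∈ e with hI
  have himg : I.image (stepDiff w) = e := by
    ext y
    simp only [hI, Finset.mem_image, Finset.mem_filter]
    refine ⟨fun ⟨i, hi, h⟩ => h ▸ hi.2, fun hy => ?_⟩
    obtain ⟨i, hi, rfl⟩ := Finset.mem_image.1 (he hy)
    exact ⟨i, ⟨hi, hy⟩, rfl⟩
  have hIc : I.card = k + 1 := by
    rw [← hk, ← himg, Finset.card_image_of_injOn]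
    intro i hi j hj hij
    simp only [hI, Finset.coe_filter, Finset.mem_range, Set.mem_ofPred_eq] at hi hj
    rcases lt_trichotomy i j with h | h | h
    · have := hdn.lt h hj.1; omega
    · exact h
    · have := hdn.lt h hi.1; omega
  have hc := enum_isAscending hIc
  have hlt : ∀ i ≤ k, enum I i < m := fun i hi =>
    Finset.mem_range.1 (Finset.mem_filter.1 (enum_mem (S := I) (by omega))).1
  -- With falling steps the first step between two vertices dominates, so each chosen step
  -- contributes its left endpoint and the final one also its right endpoint.
  let u : ℕ → ℕ := fun i => if i ≤ k then w (enum I i) else w (enum I k + 1)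
  have hstep : ∀ i ≤ k, stepDiff u i = stepDiff w (enum I i) := by
    intro i hi
    rcases hi.lt_or_eq with hi' | rfl
    · have h₁ := hc i hi'
      have h₂ := hlt (i + 1) hi'
      obtain ⟨b, hb⟩ : ∃ b, enum I (i + 1) = b + 1 := ⟨enum I (i + 1) - 1, by omega⟩
      have h := leadingDiff_chain_first hw (a := enum I i) (b := b) (by omega) (by omega)
        fun j _ hj => hdn j (by omega)
      rw [← hb] at h
      simpa [u, stepDiff, hi, Nat.succ_le_of_lt hi'] using h
    · simp [u, stepDiff]
  refine ⟨u, ?_, ?_, ?_, ?_⟩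
  · intro i hi
    rcases (Nat.lt_succ_iff.1 hi).lt_or_eq with hi' | rfl
    · simpa [u, hi'.le, Nat.succ_le_of_lt hi'] using hw.lt (hc i hi') (hlt (i + 1) hi').le
    · simpa [u] using hw _ (hlt i le_rfl)
  · intro i hi
    rw [hstep i (by omega), hstep (i + 1) (by omega)]
    exact hdn.lt (hc i (by omega)) (hlt _ (by omega))
  · intro i hi
    by_cases h : i ≤ k
    · exact ⟨_, (hlt i h).le, by simp [u, h]⟩
    · exact ⟨_, hlt k le_rfl, by simp [u, h]⟩
  · rw [← himg, ← image_enum hIc, Finset.image_image]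
    exact Finset.image_congr fun i hi => hstep i (by simpa [Nat.lt_succ_iff] using hi)

/-- Along a monotone chain, every set of `stepDiff`s is the set of `stepDiff`s of a set of vertices
of the same stepped-up color. -/
theorem exists_edge_of_monotone_chain {m k : ℕ} {w : ℕ → ℕ} {R : Finset ℕ → Prop}
    {P : (ℕ → ℕ) → Prop} (hP : ∀ u, StepsUp (k + 1) u ∨ StepsDown (k + 1) u → ¬ P u)
    (hw : IsAscending m w) (hmono : StepsUp m w ∨ StepsDown m w) {S : Finset ℕ}
    (hS : ∀ i ≤ m, w i ∈ S) {e : Finset ℕ} (he : e ⊆ (Finset.range m).image (stepDiff w))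
    (hk : e.card = k + 1) :
    ∃ f ⊆ S, f.card = k + 2 ∧ (stepUp (k + 1) R P (enum f) ↔ R e) := by
  obtain ⟨u, hu, hum, huw, hue⟩ : ∃ u : ℕ → ℕ, IsAscending (k + 1) u ∧
      (StepsUp (k + 1) u ∨ StepsDown (k + 1) u) ∧
      (∀ i ≤ k + 1, ∃ j ≤ m, u i = w j) ∧ (Finset.range (k + 1)).image (stepDiff u) = e := by
    rcases hmono with h | h
    · obtain ⟨u, h₁, h₂, h₃⟩ := exists_subchain_up hw h he hk
      exact ⟨u, h₁, Or.inl h₂, h₃⟩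
    · obtain ⟨u, h₁, h₂, h₃⟩ := exists_subchain_down hw h he hk
      exact ⟨u, h₁, Or.inr h₂, h₃⟩
  refine ⟨(Finset.range (k + 2)).image u, fun x hx => ?_, hu.card_image, ?_⟩
  · obtain ⟨i, hi, rfl⟩ := Finset.mem_image.1 hx
    obtain ⟨j, hj, h⟩ := huw i (by simpa [Nat.lt_succ_iff] using hi)
    exact h ▸ hS j hj
  · set v := enum ((Finset.range (k + 2)).image u) with hv
    have hvu : ∀ i ≤ k + 1, v i = u i := fun i hi => hu.eq_enum hi
    have hst : ∀ i < k + 1, stepDiff v i = stepDiff u i := fun i hi => by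
      rw [stepDiff, stepDiff, hvu i (by omega), hvu (i + 1) (by omega)]
    have hvm : StepsUp (k + 1) v ∨ StepsDown (k + 1) v := by
      refine hum.imp (fun h i hi => ?_) (fun h i hi => ?_)
      · rw [hst i (by omega), hst _ hi]; exact h i hi
      · rw [hst i (by omega), hst _ hi]; exact h i hi
    have himg : (Finset.range (k + 1)).image (stepDiff v) = e := by
      rw [← hue]
      exact Finset.image_congr fun i hi => hst i (by simpa using hi)
    rw [stepUp, himg]
    have := hP v hvm
    tauto

theorem stepDiff_lt {m M : ℕ} {w : ℕ → ℕ} (hM : 0 < M) (h : ∀ i ≤ m, w i < 2 ^ M) {i : ℕ}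
    (hi : i < m) : stepDiff w i < M :=
  leadingDiff_lt hM (h i hi.le) (h _ hi)

theorem card_image_stepDiff {m : ℕ} {w : ℕ → ℕ} (h : StepsUp m w ∨ StepsDown m w) :
    ((Finset.range m).image (stepDiff w)).card = m := by
  rw [Finset.card_image_of_injOn, Finset.card_range]
  intro i hi j hj hij
  simp only [Finset.coe_range, Set.mem_Iio] at hi hj
  rcases lt_trichotomy i j with hlt | hlt | hlt
  · rcases h with h | h <;> have := h.lt hlt hj <;> omega
  · exact hlt
  · rcases h with h | h <;> have := h.lt hlt hi <;> omega

theorem stepDiff_shift (w : ℕ → ℕ) (i : ℕ) :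
    stepDiff (fun j => w (1 + j)) i = stepDiff w (i + 1) := by
  simp only [stepDiff, Nat.add_comm 1]

/-- The enumeration of the image agrees with `u` only up to index `k`, but the color depends on
nothing beyond the first `k` steps. -/
theorem stepUp_enum_image {k : ℕ} {R : Finset ℕ → Prop} {P : (ℕ → ℕ) → Prop}
    (hP : ∀ u v : ℕ → ℕ, (∀ i < k, stepDiff u i = stepDiff v i) → P u → P v)
    {u : ℕ → ℕ} (hu : IsAscending k u)
    (h : stepUp k R P (enum ((Finset.range (k + 1)).image u))) : stepUp k R P u := by
  set v := enum ((Finset.range (k + 1)).image u) with hv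
  have hst : ∀ i < k, stepDiff v i = stepDiff u i := fun i hi => by
    rw [stepDiff, stepDiff, hv, hu.eq_enum (by omega), hu.eq_enum (by omega)]
  have himg : (Finset.range k).image (stepDiff v) = (Finset.range k).image (stepDiff u) :=
    Finset.image_congr fun i hi => hst i (by simpa using hi)
  rw [stepUp, himg] at h
  refine h.imp (fun h => ⟨h.1.imp (fun h i hi => ?_) (fun h i hi => ?_), h.2⟩) (hP v u hst)
  · rw [← hst i (by omega), ← hst _ hi]; exact h i hi
  · rw [← hst i (by omega), ← hst _ hi]; exact h i hi

/-- A criterion for the stepped-up coloring to avoid cliques: two overlapping red edges must form a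
monotone chain, and large sets must contain long monotone chains or an edge satisfying `P`. -/
theorem AvoidsCliques.stepUp {k n n' M : ℕ} {P : (ℕ → ℕ) → Prop} (hk : 2 ≤ k) (hM : 0 < M)
    (hc : ∀ u v : ℕ → ℕ, (∀ i < k + 1, stepDiff u i = stepDiff v i) → P u → P v)
    (hP : ∀ u, StepsUp (k + 1) u ∨ StepsDown (k + 1) u → ¬ P u)
    (hP₁ : ∀ u, P u → ¬ P fun i => u (1 + i))
    (hP₂ : ∀ u, P u → ¬ StepsUp (k + 1) (fun i => u (1 + i)) ∧
      ¬ StepsDown (k + 1) fun i => u (1 + i))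
    (hP₃ : ∀ u, (P fun i => u (1 + i)) → ¬ StepsUp (k + 1) u ∧ ¬ StepsDown (k + 1) u)
    (hlarge : ∀ S ⊆ Finset.range (2 ^ M), S.card = n' →
      (∃ w, IsAscending n w ∧ (StepsUp n w ∨ StepsDown n w) ∧ ∀ i ≤ n, w i ∈ S) ∨
      (∃ w, IsAscending (k + 1) w ∧ P w ∧ ∀ i ≤ k + 1, w i ∈ S))
    (h : AvoidsCliques (k + 1) (k + 2) n M) : AvoidsCliques (k + 2) (k + 3) n' (2 ^ M) := by
  obtain ⟨R, h₁, h₂⟩ := h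
  have himg : ∀ {S : Finset ℕ} {m : ℕ} {w : ℕ → ℕ}, S ⊆ Finset.range (2 ^ M) →
      (∀ i ≤ m, w i ∈ S) → (Finset.range m).image (stepDiff w) ⊆ Finset.range M := by
    intro S m w hS hw x hx
    obtain ⟨i, hi, rfl⟩ := Finset.mem_image.1 hx
    exact Finset.mem_range.2 (stepDiff_lt hM
      (fun i hi => Finset.mem_range.1 (hS (hw i hi))) (Finset.mem_range.1 hi))
  refine ⟨fun e => _root_.stepUp (k + 1) R P (enum e), fun S hS hSc => ?_, fun S hS hSc => ?_⟩
  · by_contra! hred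
    set w := enum S with hw
    have hwm : ∀ i ≤ k + 2, w i ∈ S := fun i hi => enum_mem (by omega)
    have hwa : IsAscending (k + 2) w := enum_isAscending hSc
    have hsub : ∀ u : ℕ → ℕ, IsAscending (k + 1) u → (∀ i ≤ k + 1, u i ∈ S) →
        _root_.stepUp (k + 1) R P u := by
      intro u hu hum
      refine stepUp_enum_image hc hu (hred _ (fun x hx => ?_) hu.card_image)
      obtain ⟨i, hi, rfl⟩ := Finset.mem_image.1 hx
      exact hum i (by simpa [Nat.lt_succ_iff] using hi)
    have hm : StepsUp (k + 2) w ∨ StepsDown (k + 2) w := by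
      have e₁ := hsub w (fun i hi => hwa i (by omega)) fun i hi => hwm i (by omega)
      have e₂ := hsub (fun i => w (1 + i)) (hwa.shift (by omega)) fun i hi => hwm _ (by omega)
      -- Of the nine combinations only up/up and down/down survive. Opposite directions clash on
      -- steps 1 and 2, which both edges contain because `2 ≤ k`; the rest is excluded by the
      -- hypotheses on `P`.
      rcases e₁ with ⟨e₁ | e₁, -⟩ | e₁ <;> rcases e₂ with ⟨e₂ | e₂, -⟩ | e₂
      · left
        intro i hi
        rcases i with _ | i
        · exact e₁ 0 (by omega)
        · have := e₂ i (by omega)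
          simpa [stepDiff, add_comm, add_left_comm] using this
      · have a := e₁ 1 (by omega)
        have b := e₂ 0 (by omega)
        simp only [stepDiff_shift, Nat.reduceAdd] at a b
        omega
      · exact absurd e₁ (hP₃ w e₂).1
      · have a := e₁ 1 (by omega)
        have b := e₂ 0 (by omega)
        simp only [stepDiff_shift, Nat.reduceAdd] at a b
        omega
      · right
        intro i hi
        rcases i with _ | i
        · exact e₁ 0 (by omega)
        · have := e₂ i (by omega)
          simpa [stepDiff, add_comm, add_left_comm] using this
      · exact absurd e₁ (hP₃ w e₂).2
      · exact absurd e₂ (hP₂ w e₁).1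
      · exact absurd e₂ (hP₂ w e₁).2
      · exact absurd e₂ (hP₁ w e₁)
    obtain ⟨e, he, hec, hR⟩ := h₁ _ (himg hS hwm) (card_image_stepDiff hm)
    obtain ⟨f, hf, hfc, hfR⟩ := exists_edge_of_monotone_chain (R := R) hP hwa hm hwm he hec
    exact hR (hfR.1 (hred f hf hfc))
  · rcases hlarge S hS hSc with ⟨w, hwa, hm, hwm⟩ | ⟨w, hwa, hPw, hwm⟩
    · obtain ⟨e, he, hec, hR⟩ := h₂ _ (himg hS hwm) (card_image_stepDiff hm)
      obtain ⟨f, hf, hfc, hfR⟩ := exists_edge_of_monotone_chain (R := R) hP hwa hm hwm he hec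
      exact ⟨f, hf, hfc, hfR.2 hR⟩
    · refine ⟨(Finset.range (k + 2)).image w, fun x hx => ?_, hwa.card_image, Or.inr ?_⟩
      · obtain ⟨i, hi, rfl⟩ := Finset.mem_image.1 hx
        exact hwm i (by simpa [Nat.lt_succ_iff] using hi)
      · refine hc w _ (fun i hi => ?_) hPw
        rw [stepDiff, stepDiff, hwa.eq_enum (by omega), hwa.eq_enum (by omega)]

/-! ### Monotone chains: from uniformity 3 to 4 -/

/-- A set of `2 ^ (a + b)` numbers contains a chain with `a` increasing or `b` decreasing
`stepDiff`s. -/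
theorem exists_monotone_chain (M : ℕ) : ∀ (q a b : ℕ) (S : Finset ℕ),
    (∀ x ∈ S, x / 2 ^ M = q) → 2 ^ (a + b) ≤ S.card →
    (∃ w, IsAscending a w ∧ StepsUp a w ∧ ∀ i ≤ a, w i ∈ S) ∨
    (∃ w, IsAscending b w ∧ StepsDown b w ∧ ∀ i ≤ b, w i ∈ S) := by
  induction M with
  | zero =>
    intro q a b S hS hc
    have h₁ : S.card ≤ 1 := Finset.card_le_one.2 fun x hx y hy => by
      have := hS x hx; have := hS y hy; simp_all
    have h₂ : a + b < 2 ^ (a + b) := Nat.lt_two_pow_self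
    obtain ⟨x, hx⟩ : S.Nonempty := Finset.card_pos.1 (by omega)
    have ha : a = 0 := by omega
    subst ha
    exact Or.inl ⟨fun _ => x, fun i hi => by omega, fun i hi => by omega, fun i hi => hx⟩
  | succ M ih =>
    intro q a b S hS hc
    have hpos : 0 < 2 ^ (a + b) := by positivity
    obtain ⟨x₀, hx₀⟩ : S.Nonempty := Finset.card_pos.1 (by omega)
    rcases a with _ | a
    · exact Or.inl ⟨fun _ => x₀, fun i hi => by omega, fun i hi => by omega, fun i hi => hx₀⟩
    rcases b with _ | b
    · exact Or.inr ⟨fun _ => x₀, fun i hi => by omega, fun i hi => by omega, fun i hi => hx₀⟩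
    set L := S.filter fun x => x / 2 ^ M = 2 * q with hL
    set U := S.filter fun x => ¬ x / 2 ^ M = 2 * q with hU
    have hLU : L.card + U.card = S.card := Finset.card_filter_add_card_filter_not _
    have hLq : ∀ x ∈ L, x / 2 ^ M = 2 * q := fun x hx => (Finset.mem_filter.1 hx).2
    have hUq : ∀ x ∈ U, x / 2 ^ M = 2 * q + 1 := fun x hx => by
      have h₁ := (Finset.mem_filter.1 hx).2
      have h₂ := hS x (Finset.mem_filter.1 hx).1
      rw [pow_succ, ← Nat.div_div_eq_div_mul] at h₂
      omega
    have hLS : L ⊆ S := Finset.filter_subset _ _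
    have hUS : U ⊆ S := Finset.filter_subset _ _
    rcases L.eq_empty_or_nonempty with hLe | ⟨x, hx⟩
    · rw [hLe, Finset.card_empty, zero_add] at hLU
      exact (ih _ (a + 1) (b + 1) U hUq (by omega)).imp
        (fun ⟨w, h₁, h₂, h₃⟩ => ⟨w, h₁, h₂, fun i hi => hUS (h₃ i hi)⟩)
        (fun ⟨w, h₁, h₂, h₃⟩ => ⟨w, h₁, h₂, fun i hi => hUS (h₃ i hi)⟩)
    rcases U.eq_empty_or_nonempty with hUe | ⟨y, hy⟩
    · rw [hUe, Finset.card_empty, add_zero] at hLU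
      exact (ih _ (a + 1) (b + 1) L hLq (by omega)).imp
        (fun ⟨w, h₁, h₂, h₃⟩ => ⟨w, h₁, h₂, fun i hi => hLS (h₃ i hi)⟩)
        (fun ⟨w, h₁, h₂, h₃⟩ => ⟨w, h₁, h₂, fun i hi => hLS (h₃ i hi)⟩)
    have hlt : ∀ u ∈ L, ∀ v ∈ U, u < v := by
      intro u hu v hv
      have h₁ := hLq u hu
      have h₂ := hUq v hv
      by_contra! hle
      have := Nat.div_le_div_right (c := 2 ^ M) hle
      omega
    have htop : ∀ u ∈ L, ∀ v ∈ U, leadingDiff u v = M := by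
      intro u hu v hv
      refine leadingDiff_eq (by rw [hLq u hu, hUq v hv]; omega) ?_
      rw [hS u (hLS hu), hS v (hUS hv)]
    have hlow : ∀ c, ∀ u v, u < v → u / 2 ^ M = c → v / 2 ^ M = c → leadingDiff u v < M := by
      intro c u v huv hu hv
      by_contra! hle
      exact div_ne_div_leadingDiff huv.ne (div_eq_div_of_le hle (hu.trans hv.symm))
    have hpow : 2 ^ (a + 1 + (b + 1)) = 2 ^ (a + (b + 1)) + 2 ^ (a + 1 + b) := by
      rw [show a + 1 + (b + 1) = a + (b + 1) + 1 by ring, pow_succ,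
        show a + 1 + b = a + (b + 1) by ring]
      ring
    -- One half by the digit `M` keeps half of the required size. A rising chain in the lower half
    -- extends at its end by `y`, a falling chain in the upper half at its start by `x`; the new
    -- step is `M`, above all others.
    rcases le_or_gt (2 ^ (a + (b + 1))) L.card with hc' | hc'
    · rcases ih _ a (b + 1) L hLq hc' with ⟨w, h₁, h₂, h₃⟩ | ⟨w, h₁, h₂, h₃⟩
      · left
        refine ⟨fun i => if i ≤ a then w i else y, fun i hi => ?_, fun i hi => ?_, fun i hi => ?_⟩
        · rcases (Nat.lt_succ_iff.1 hi).lt_or_eq with hi | rfl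
          · simpa [hi.le, Nat.succ_le_of_lt hi] using h₁ i hi
          · simpa using hlt _ (h₃ i le_rfl) y hy
        · have hi : i + 1 ≤ a := by omega
          rcases hi.lt_or_eq with hi' | rfl
          · simpa [stepDiff, hi, (Nat.le_succ i).trans hi, Nat.succ_le_of_lt hi']
              using h₂ i hi'
          · have e := hlow _ _ _ (h₁ i (by omega)) (hLq _ (h₃ i (by omega)))
              (hLq _ (h₃ (i + 1) le_rfl))
            simpa [stepDiff, htop _ (h₃ (i + 1) le_rfl) y hy] using e
        · by_cases h : i ≤ a
          · simpa [h] using hLS (h₃ i h)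
          · simpa [h] using hUS hy
      · exact Or.inr ⟨w, h₁, h₂, fun i hi => hLS (h₃ i hi)⟩
    · rcases ih _ (a + 1) b U hUq (by omega) with ⟨w, h₁, h₂, h₃⟩ | ⟨w, h₁, h₂, h₃⟩
      · exact Or.inl ⟨w, h₁, h₂, fun i hi => hUS (h₃ i hi)⟩
      · right
        refine ⟨fun i => if i = 0 then x else w (i - 1), fun i hi => ?_, fun i hi => ?_,
          fun i hi => ?_⟩
        · rcases i with _ | i
          · simpa using hlt x hx _ (h₃ 0 (by omega))
          · simpa using h₁ i (by omega)
        · rcases i with _ | i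
          · have e := hlow _ _ _ (h₁ 0 (by omega)) (hUq _ (h₃ 0 (by omega)))
              (hUq _ (h₃ 1 (by omega)))
            simpa [stepDiff, htop x hx _ (h₃ 0 (by omega))] using e
          · simpa [stepDiff] using h₂ i (by omega)
        · rcases i with _ | i
          · simpa using hLS hx
          · simpa using hUS (h₃ i (by omega))

theorem AvoidsCliques.four_five {n M : ℕ} (hM : 0 < M) (h : AvoidsCliques 3 4 n M) :
    AvoidsCliques 4 5 (2 ^ (2 * n)) (2 ^ M) := by
  refine AvoidsCliques.stepUp (k := 2) (P := fun _ => False) le_rfl hM (by simp) (by simp)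
    (by simp) (by simp) (by simp) (fun S hS hSc => Or.inl ?_) h
  rcases exists_monotone_chain M 0 n n S
    (fun x hx => Nat.div_eq_of_lt (Finset.mem_range.1 (hS hx))) (by rw [hSc, two_mul]) with
    ⟨w, h₁, h₂, h₃⟩ | ⟨w, h₁, h₂, h₃⟩
  · exact ⟨w, h₁, Or.inl h₂, h₃⟩
  · exact ⟨w, h₁, Or.inr h₂, h₃⟩

/-! ### Zigzags: from uniformity at least 4 upwards -/

/-- The first `stepDiff`s go up, down and up again. -/
def Zigzag (u : ℕ → ℕ) : Prop :=
  stepDiff u 0 < stepDiff u 1 ∧ stepDiff u 2 < stepDiff u 1 ∧ stepDiff u 2 < stepDiff u 3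

/-- A long chain contains a long monotone chain or a chain that begins with a zigzag. -/
theorem exists_monotone_or_zigzag {n k m : ℕ} (hk : 4 ≤ k) (hm : 3 * n + k ≤ m) {w : ℕ → ℕ}
    (hw : IsAscending m w) :
    (∃ u, IsAscending n u ∧ (StepsUp n u ∨ StepsDown n u) ∧ ∀ i ≤ n, ∃ j ≤ m, u i = w j) ∨
    (∃ u, IsAscending k u ∧ Zigzag u ∧ ∀ i ≤ k, ∃ j ≤ m, u i = w j) := by
  by_cases hmono : ∃ a, a + n ≤ m ∧
      (StepsUp n (fun i => w (a + i)) ∨ StepsDown n fun i => w (a + i))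
  · obtain ⟨a, ha, h⟩ := hmono
    exact Or.inl ⟨_, hw.shift ha, h, fun i hi => ⟨a + i, by omega, rfl⟩⟩
  right
  push Not at hmono
  have hne : ∀ i, i + 1 < m → stepDiff w i ≠ stepDiff w (i + 1) := fun i hi =>
    leadingDiff_ne (hw i (by omega)) (hw (i + 1) hi)
  have hasc : ∀ a, a + n ≤ m → ∃ i, a ≤ i ∧ i + 1 < a + n ∧
      stepDiff w i < stepDiff w (i + 1) := by
    intro a ha
    have h := (hmono a ha).2
    simp only [StepsDown, not_forall, not_lt] at h
    obtain ⟨i, hi, h⟩ := h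
    exact ⟨a + i, by omega, by omega, lt_of_le_of_ne h (hne _ (by omega))⟩
  have hdesc : ∀ a, a + n ≤ m → ∃ i, a ≤ i ∧ i + 1 < a + n ∧
      stepDiff w (i + 1) < stepDiff w i := by
    intro a ha
    have h := (hmono a ha).1
    simp only [StepsUp, not_forall, not_lt] at h
    obtain ⟨i, hi, h⟩ := h
    exact ⟨a + i, by omega, by omega, lt_of_le_of_ne h (hne _ (by omega)).symm⟩
  obtain ⟨i, -, hi, hup⟩ := hasc 0 (by omega)
  classical
  have ex₁ := hdesc (i + 1) (by omega)
  set j := Nat.find ex₁ with hj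
  obtain ⟨hij, hjn, hjd⟩ := Nat.find_spec ex₁
  rw [← hj] at hij hjn hjd
  have hup' : stepDiff w (j - 1) < stepDiff w j := by
    rcases hij.eq_or_lt with h | h
    · rw [← h]; exact hup
    · have h₁ := Nat.find_min ex₁ (m := j - 1) (by omega)
      have h₂ := hne (j - 1) (by omega)
      rw [show j - 1 + 1 = j by omega] at h₁ h₂
      by_contra! hle
      exact h₁ ⟨by omega, by omega, lt_of_le_of_ne hle h₂.symm⟩
  have ex₂ := hasc (j + 1) (by omega)
  set l := Nat.find ex₂ with hl
  obtain ⟨hjl, hln, hlu⟩ := Nat.find_spec ex₂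
  rw [← hl] at hjl hln hlu
  have hdn : ∀ t, j ≤ t → t < l → stepDiff w (t + 1) < stepDiff w t := by
    intro t ht htl
    rcases ht.eq_or_lt with rfl | h
    · exact hjd
    · have h₁ := Nat.find_min ex₂ htl
      by_contra! hle
      exact h₁ ⟨by omega, by omega, lt_of_le_of_ne hle (hne _ (by omega))⟩
  obtain ⟨p, hp⟩ : ∃ p, l = p + 1 := ⟨l - 1, by omega⟩
  rw [hp] at hjl hln hlu hdn
  have hmid : leadingDiff (w j) (w (p + 1)) = stepDiff w j :=
    leadingDiff_chain_first hw (by omega) (by omega) fun t ht htp => hdn t ht (by omega)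
  have hlj : stepDiff w (p + 1) < stepDiff w j := by
    have h := lt_of_succ_lt_of_lt (f := fun t => stepDiff w (j + t)) (m := p + 1 - j)
      (i := 0) (j := p + 1 - j) (fun t ht => hdn (j + t) (by omega) (by omega)) (by omega) le_rfl
    simpa [show j + (p + 1 - j) = p + 1 by omega] using h
  -- Here j is a peak and p + 1 the valley where the descent from it ends. Skipping the vertices
  -- strictly between gives steps j - 1, j, p + 1, p + 2, a zigzag; the remaining vertices are
  -- consecutive.
  refine ⟨fun t => if t = 0 then w (j - 1) else if t = 1 then w j else w (p + (t - 1)),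
    fun t ht => ?_, ?_, fun t ht => ?_⟩
  · rcases t with _ | _ | t
    · simpa using hw.lt (i := j - 1) (j := j) (by omega) (by omega)
    · simpa using hw.lt (i := j) (j := p + 1) (by omega) (by omega)
    · simpa [add_assoc] using hw (p + (t + 1)) (by omega)
  · have e₀ : leadingDiff (w (j - 1)) (w j) = stepDiff w (j - 1) := by
      rw [stepDiff, show j - 1 + 1 = j by omega]
    refine ⟨?_, ?_, ?_⟩
    · simpa [stepDiff, hmid, e₀] using hup'
    · simpa [stepDiff, hmid] using hlj
    · simpa [stepDiff] using hlu
  · rcases t with _ | _ | t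
    · exact ⟨j - 1, by omega, by simp⟩
    · exact ⟨j, by omega, by simp⟩
    · exact ⟨p + (t + 1), by omega, by simp⟩

/-- The final ascent of `Zigzag` prevents the next edge from being falling; it needs four steps,
hence the bound on `k`. -/
theorem AvoidsCliques.succ {k n M : ℕ} (hk : 4 ≤ k) (hM : 0 < M)
    (h : AvoidsCliques k (k + 1) n M) :
    AvoidsCliques (k + 1) (k + 2) (3 * n + k + 1) (2 ^ M) := by
  obtain ⟨k, rfl⟩ := Nat.exists_eq_add_of_le' (show 1 ≤ k by omega)
  refine AvoidsCliques.stepUp (P := Zigzag) (by omega) hM (fun u v huv hu => ?_) ?_ ?_ ?_ ?_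
    (fun S hS hSc => ?_) h
  · rw [Zigzag, huv 0 (by omega), huv 1 (by omega), huv 2 (by omega), huv 3 (by omega)] at hu
    exact hu
  · rintro u (h | h) ⟨h₁, h₂, h₃⟩
    · have := h 1 (by omega)
      simp only [Nat.reduceAdd] at this
      omega
    · have := h 0 (by omega)
      simp only [Nat.reduceAdd] at this
      omega
  · rintro u ⟨h₁, h₂, h₃⟩ ⟨h₄, h₅, h₆⟩
    simp only [stepDiff_shift, Nat.reduceAdd] at *
    omega
  · rintro u ⟨h₁, h₂, h₃⟩
    refine ⟨fun h => ?_, fun h => ?_⟩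
    · have := h 0 (by omega)
      simp only [stepDiff_shift, Nat.reduceAdd] at *
      omega
    · have := h 1 (by omega)
      simp only [stepDiff_shift, Nat.reduceAdd] at *
      omega
  · rintro u ⟨h₁, h₂, h₃⟩
    refine ⟨fun h => ?_, fun h => ?_⟩
    · have := h 2 (by omega)
      simp only [stepDiff_shift, Nat.reduceAdd] at *
      omega
    · have := h 1 (by omega)
      simp only [stepDiff_shift, Nat.reduceAdd] at *
      omega
  · have hmem : ∀ j ≤ 3 * n + (k + 1), enum S j ∈ S := fun j hj => enum_mem (by omega)
    rcases exists_monotone_or_zigzag hk le_rfl (enum_isAscending hSc) with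
      ⟨u, h₁, h₂, h₃⟩ | ⟨u, h₁, h₂, h₃⟩
    · refine Or.inl ⟨u, h₁, h₂, fun i hi => ?_⟩
      obtain ⟨j, hj, h⟩ := h₃ i hi
      exact h ▸ hmem j hj
    · refine Or.inr ⟨u, h₁, h₂, fun i hi => ?_⟩
      obtain ⟨j, hj, h⟩ := h₃ i hi
      exact h ▸ hmem j hj

/-! ### The parabola digraph -/

/-- The arcs of a digraph without transitive triangles on the plane over a field. -/
def ParabolaArc {F : Type*} [Field F] (x y : F × F) : Prop := ∃ t : F, t ≠ 0 ∧ y = x + (t, t ^ 2)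

/-- A transitive triangle would give (s + t)² = s² + t², that is 2st = 0. -/
theorem ParabolaArc.not_transitive {F : Type*} [Field F] (h2 : (2 : F) ≠ 0) {x y z : F × F}
    (hxy : ParabolaArc x y) (hyz : ParabolaArc y z) : ¬ ParabolaArc x z := by
  rintro ⟨u, -, hu⟩
  obtain ⟨s, hs, rfl⟩ := hxy
  obtain ⟨t, ht, rfl⟩ := hyz
  have h₁ := congrArg Prod.fst hu
  have h₂ := congrArg Prod.snd hu
  simp only [Prod.fst_add, Prod.snd_add] at h₁ h₂
  have h₃ : s + t = u := by linear_combination h₁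
  subst h₃
  have : 2 * (s * t) = 0 := by linear_combination -h₂
  simp_all

/-- Two sets in the plane of order `q` without arcs from one to the other cannot both be large. -/
theorem card_mul_card_le_of_no_arc {F : Type*} [Field F] [Fintype F] [DecidableEq F]
    (h2 : (2 : F) ≠ 0) (A B : Finset (F × F))
    (hAB : ∀ x ∈ A, ∀ y ∈ B, ¬ ParabolaArc x y) :
    A.card * B.card ≤ 2 * Fintype.card F * B.card + Fintype.card F ^ 3 := by
  set q := Fintype.card F with hq
  have hq0 : 0 < q := Fintype.card_pos
  obtain ⟨u, hu⟩ : ∃ u, q = u + 1 := ⟨q - 1, by omega⟩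
  let U : Finset F := Finset.univ.erase 0
  have hU : U.card = u := by
    rw [Finset.card_erase_of_mem (Finset.mem_univ _), Finset.card_univ]; omega
  let D : F × F → Finset F := fun x => U.filter fun t => x + (t, t ^ 2) ∈ B
  have hDA : ∀ x ∈ A, (D x).card = 0 := by
    intro x hx
    rw [Finset.card_eq_zero, Finset.filter_eq_empty_iff]
    exact fun t ht h => hAB x hx _ h ⟨t, Finset.ne_of_mem_erase ht, rfl⟩
  have hsum : ∑ x, (D x).card = u * B.card := by
    simp only [D, Finset.card_filter]
    rw [Finset.sum_comm, ← hU, ← smul_eq_mul, ← Finset.sum_const]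
    refine Finset.sum_congr rfl fun t _ => ?_
    have h := Equiv.sum_comp (Equiv.addRight (t, t ^ 2)) fun y => if y ∈ B then 1 else 0
    exact h.trans (by simp)
  have hsq : ∑ x, (D x).card ^ 2 ≤ u * B.card + B.card ^ 2 := by
    have h₁ : ∀ x, (D x).card ^ 2 = (D x).card + (D x).offDiag.card := by
      intro x
      rw [Finset.offDiag_card, sq]
      have := Nat.le_mul_self (D x).card
      omega
    rw [Finset.sum_congr rfl fun x _ => h₁ x, Finset.sum_add_distrib, hsum]
    refine Nat.add_le_add_left ?_ _
    rw [sq, ← Finset.card_product, ← Finset.card_sigma]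
    -- Two points of `B` determine s - t and s² - t², hence s + t since s ≠ t, and then s and t
    -- since 2 ≠ 0.
    refine Finset.card_le_card_of_injOn
      (fun p => (p.1 + (p.2.1, p.2.1 ^ 2), p.1 + (p.2.2, p.2.2 ^ 2))) ?_ ?_
    · rintro ⟨x, s, t⟩ h
      simp only [Finset.coe_sigma, Set.mem_sigma_iff, Finset.mem_coe, Finset.mem_offDiag, D,
        Finset.mem_filter] at h
      exact Finset.mem_product.2 ⟨h.2.1.2, h.2.2.1.2⟩
    · rintro ⟨⟨x₁, x₂⟩, s, t⟩ h ⟨⟨y₁, y₂⟩, s', t'⟩ h' he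
      simp only [Finset.coe_sigma, Set.mem_sigma_iff, Finset.mem_coe, Finset.mem_offDiag] at h h'
      simp only [Prod.mk_add_mk, Prod.mk.injEq] at he
      obtain ⟨⟨e₁, e₂⟩, e₃, e₄⟩ := he
      have hst : s - t ≠ 0 := sub_ne_zero.2 h.2.2.2
      have e₅ : s - t = s' - t' := by linear_combination e₁ - e₃
      have e₆ : s + t = s' + t' := by
        refine mul_left_cancel₀ hst ?_
        linear_combination e₂ - e₄ - (s' + t') * e₅
      have e₇ : s = s' := mul_left_cancel₀ h2 (by linear_combination e₅ + e₆)
      subst e₇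
      have e₈ : t = t' := by linear_combination e₆
      subst e₈
      have e₉ : x₁ = y₁ := by linear_combination e₁
      have e₁₀ : x₂ = y₂ := by linear_combination e₂
      subst e₉ e₁₀
      rfl
  -- Cauchy–Schwarz over the complement of `A`, which carries the whole sum because the degrees into
  -- `B` vanish on `A`.
  have hcs : (u * B.card) ^ 2 ≤ (q ^ 2 - A.card) * (u * B.card + B.card ^ 2) := by
    have h₁ : ∑ x ∈ Aᶜ, (D x).card = u * B.card := by
      rw [← hsum, ← Finset.sum_add_sum_compl A, Finset.sum_eq_zero hDA, zero_add]
    have h₂ : (Aᶜ).card = q ^ 2 - A.card := by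
      rw [Finset.card_compl, Fintype.card_prod, sq]
    rw [← h₁, ← h₂]
    refine sq_sum_le_card_mul_sum_sq.trans (Nat.mul_le_mul_left _ ?_)
    rw [h₁]
    exact (Finset.sum_le_sum_of_subset (Finset.subset_univ _)).trans hsq
  have hA : A.card ≤ q ^ 2 := by
    simpa [sq] using Finset.card_le_univ A
  obtain ⟨c, hc⟩ := Nat.exists_eq_add_of_le hA
  rw [hc, Nat.add_sub_cancel_left] at hcs
  rcases B.card.eq_zero_or_pos with hb | hb
  · simp [hb]
  · have h₁ : u ^ 2 * B.card ≤ c * (u + B.card) := by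
      refine Nat.le_of_mul_le_mul_right ?_ hb
      calc u ^ 2 * B.card * B.card = (u * B.card) ^ 2 := by ring
        _ ≤ _ := hcs
        _ = _ := by ring
    have h₂ : (u + 1) ^ 2 * (u + B.card) = A.card * (u + B.card) + c * (u + B.card) := by
      rw [← hu, hc]; ring
    rw [hu]
    nlinarith [Nat.zero_le (A.card * u), Nat.zero_le (u ^ 2), Nat.zero_le u]

/-! ### Random colorings of pairs -/

/-- The functions taking few values on a given set are few. -/
theorem card_few_values_le {α K : Type*} [Fintype α] [DecidableEq α] [Fintype K] [DecidableEq K]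
    (S : Finset α) {T : ℕ} (hT : T ≤ Fintype.card K) :
    (Finset.univ.filter fun g : α → K => (S.image g).card < T).card ≤
      Fintype.card K ^ T * (T ^ S.card * Fintype.card K ^ (Fintype.card α - S.card)) := by
  have hsub : (Finset.univ.filter fun g : α → K => (S.image g).card < T) ⊆
      (Finset.powersetCard T (Finset.univ : Finset K)).biUnion fun U =>
        Fintype.piFinset fun i => if i ∈ S then U else Finset.univ := by
    intro g hg
    have hg := (Finset.mem_filter.1 hg).2
    obtain ⟨U, hU₁, hU₂⟩ := Finset.exists_superset_card_eq hg.le hT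
    refine Finset.mem_biUnion.2 ⟨U, by simp [Finset.mem_powersetCard, hU₂], ?_⟩
    refine Fintype.mem_piFinset.2 fun i => ?_
    split_ifs with hi
    · exact hU₁ (Finset.mem_image_of_mem _ hi)
    · exact Finset.mem_univ _
  refine (Finset.card_le_card hsub).trans (Finset.card_biUnion_le.trans ?_)
  have hcard : ∀ U ∈ Finset.powersetCard T (Finset.univ : Finset K),
      (Fintype.piFinset fun i : α => if i ∈ S then U else Finset.univ).card =
        T ^ S.card * Fintype.card K ^ (Fintype.card α - S.card) := by
    intro U hU
    rw [Fintype.card_piFinset]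
    simp only [apply_ite Finset.card, (Finset.mem_powersetCard.1 hU).2, Finset.card_univ]
    rw [Finset.prod_ite, Finset.prod_const, Finset.prod_const]
    congr 2
    · simp
    · rw [← Finset.card_compl]
      congr 1
      ext; simp
  rw [Finset.sum_congr rfl hcard, Finset.sum_const, smul_eq_mul, Finset.card_powersetCard,
    Finset.card_univ]
  exact Nat.mul_le_mul_right _ (Nat.choose_le_pow _ _)

/-- A random coloring of the ordered pairs takes many colors between suitable vertices of `S₁` and
both `S₂` and `S₃`, for all sets `S₁`, `S₂`, `S₃` of `h` vertices. -/
theorem exists_pair_coloring {K : Type*} [Fintype K] [DecidableEq K] {N T h : ℕ} (hh : 0 < h)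
    (hhN : h ≤ N) (hT : T ≤ Fintype.card K)
    (hlt : N ^ 3 * (2 * (Fintype.card K ^ T * T ^ h)) < Fintype.card K ^ h) :
    ∃ f : Fin N → Fin N → K, ∀ S₁ S₂ S₃ : Finset (Fin N), S₁.card = h → S₂.card = h →
      S₃.card = h → ∃ a ∈ S₁, T ≤ (S₂.image (f a)).card ∧ T ≤ (S₃.image (f a)).card := by
  set r := Fintype.card K with hr
  let bad : Finset (Fin N) × Finset (Fin N) → Finset (Fin N → K) := fun p =>
    Finset.univ.filter fun g => (p.1.image g).card < T ∨ (p.2.image g).card < T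
  let H := Finset.powersetCard h (Finset.univ : Finset (Fin N))
  let B : Finset (Fin N → Fin N → K) := (H ×ˢ (H ×ˢ H)).biUnion fun p =>
    Fintype.piFinset fun a => if a ∈ p.1 then bad p.2 else Finset.univ
  set b := 2 * (r ^ T * (T ^ h * r ^ (N - h))) with hb
  have hbad : ∀ p ∈ H ×ˢ H, (bad p).card ≤ b := by
    intro p hp
    obtain ⟨h₁, h₂⟩ := Finset.mem_product.1 hp
    have h₁ := (Finset.mem_powersetCard.1 h₁).2
    have h₂ := (Finset.mem_powersetCard.1 h₂).2
    have e₁ := card_few_values_le (K := K) p.1 hT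
    have e₂ := card_few_values_le (K := K) p.2 hT
    rw [h₁, Fintype.card_fin] at e₁
    rw [h₂, Fintype.card_fin] at e₂
    simp only [bad, Finset.filter_or]
    refine (Finset.card_union_le _ _).trans ?_
    rw [hb, two_mul]
    exact Nat.add_le_add e₁ e₂
  have hH : H.card ≤ N ^ h := by
    rw [Finset.card_powersetCard, Finset.card_univ, Fintype.card_fin]
    exact Nat.choose_le_pow _ _
  -- Union bound over at most (N³)^h triples of sets: the `h` rows indexed by the first set are bad
  -- independently, so N³ is charged to each of these rows.
  have hBcard : B.card ≤ (N ^ 3 * b) ^ h * (r ^ N) ^ (N - h) := by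
    refine Finset.card_biUnion_le.trans ?_
    have hle : ∀ p ∈ H ×ˢ (H ×ˢ H),
        (Fintype.piFinset fun a : Fin N => if a ∈ p.1 then bad p.2 else Finset.univ).card ≤
          b ^ h * (r ^ N) ^ (N - h) := by
      intro p hp
      obtain ⟨h₁, h₂⟩ := Finset.mem_product.1 hp
      have h₁ := (Finset.mem_powersetCard.1 h₁).2
      rw [Fintype.card_piFinset]
      simp only [apply_ite Finset.card, Finset.card_univ, Fintype.card_fun, Fintype.card_fin]
      rw [Finset.prod_ite, Finset.prod_const, Finset.prod_const]
      refine Nat.mul_le_mul ?_ (le_of_eq ?_)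
      · rw [show (Finset.univ.filter fun x => x ∈ p.1) = p.1 by simp, h₁]
        exact Nat.pow_le_pow_left (hbad _ h₂) _
      · congr 1
        rw [Finset.filter_not, show (Finset.univ.filter fun x => x ∈ p.1) = p.1 by simp,
          Finset.card_univ_sdiff, h₁, Fintype.card_fin]
    refine (Finset.sum_le_card_nsmul _ _ _ hle).trans ?_
    rw [smul_eq_mul, Finset.card_product, Finset.card_product, mul_pow (N ^ 3) b, mul_assoc ((N ^ 3) ^ h)]
    refine Nat.mul_le_mul_right _ ?_
    calc H.card * (H.card * H.card) ≤ N ^ h * (N ^ h * N ^ h) := by gcongr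
      _ = (N ^ 3) ^ h := by rw [← pow_mul]; ring
  have hBlt : B.card < Fintype.card (Fin N → Fin N → K) := by
    refine hBcard.trans_lt ?_
    rw [Fintype.card_fun, Fintype.card_fun, Fintype.card_fin, ← hr]
    have hr0 : 0 < r := by
      by_contra! h0
      have : r = 0 := by omega
      rw [this, zero_pow hh.ne'] at hlt
      omega
    have h₁ : N ^ 3 * b < r ^ N := by
      calc N ^ 3 * b = N ^ 3 * (2 * (r ^ T * T ^ h)) * r ^ (N - h) := by rw [hb]; ring
        _ < r ^ h * r ^ (N - h) := Nat.mul_lt_mul_of_pos_right hlt (by positivity)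
        _ = r ^ N := by rw [← pow_add, Nat.add_sub_cancel' hhN]
    calc (N ^ 3 * b) ^ h * (r ^ N) ^ (N - h) < (r ^ N) ^ h * (r ^ N) ^ (N - h) :=
          Nat.mul_lt_mul_of_pos_right (Nat.pow_lt_pow_left h₁ hh.ne') (by positivity)
      _ = (r ^ N) ^ N := by rw [← pow_add, Nat.add_sub_cancel' hhN]
  obtain ⟨f, hf⟩ : ∃ f, f ∉ B := by
    by_contra! hall
    rw [Finset.eq_univ_of_forall hall, Finset.card_univ] at hBlt
    exact lt_irrefl _ hBlt
  refine ⟨f, fun S₁ S₂ S₃ h₁ h₂ h₃ => ?_⟩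
  by_contra! hno
  refine hf (Finset.mem_biUnion.2 ⟨(S₁, S₂, S₃), by simp [H, h₁, h₂, h₃], ?_⟩)
  refine Fintype.mem_piFinset.2 fun a => ?_
  split_ifs with ha
  · simp only [bad, Finset.mem_filter, Finset.mem_univ, true_and]
    by_cases hT₂ : T ≤ (S₂.image (f a)).card
    · exact Or.inr (hno a ha hT₂)
    · exact Or.inl (not_le.1 hT₂)
  · exact Finset.mem_univ _

/-! ### The 3-uniform coloring -/

theorem enum_triple {a b c : ℕ} (hab : a < b) (hbc : b < c) :
    enum {a, b, c} 0 = a ∧ enum {a, b, c} 1 = b ∧ enum {a, b, c} 2 = c := by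
  let u : ℕ → ℕ := fun i => if i = 0 then a else if i = 1 then b else c
  have hu : IsAscending 2 u := by
    intro i hi
    interval_cases i <;> simpa [u]
  have himg : (Finset.range 3).image u = {a, b, c} := by
    ext y
    simp [Finset.range_add_one, u]
    tauto
  have h := fun i (hi : i ≤ 2) => hu.eq_enum hi
  simp only [Nat.reduceAdd, himg] at h
  exact ⟨h 0 (by omega), h 1 (by omega), h 2 le_rfl⟩

/-- Triples are colored by the parabola arcs between the colors of two of their pairs. -/
theorem avoidsCliques_three_four_of_field {F : Type*} [Field F] [Fintype F]
    (h2 : (2 : F) ≠ 0) {x : ℕ} (hx : 9 ≤ x) (hF : Fintype.card F = x ^ 2) :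
    AvoidsCliques 3 4 (96 * x ^ 3) (x ^ (2 * x ^ 3)) := by
  classical
  set T := 2 * x ^ 3 with hTdef
  set N := x ^ T with hN
  set h := 16 * T with hh
  have hTpos : 0 < T := by positivity
  have hK : Fintype.card (F × F) = x ^ 4 := by rw [Fintype.card_prod, hF]; ring
  have hhN : h ≤ N := by
    have h₁ : T < 2 ^ T := Nat.lt_two_pow_self
    have h₂ : 16 ≤ 4 ^ T :=
      calc 16 = 4 ^ 2 := rfl
        _ ≤ 4 ^ T := Nat.pow_le_pow_right (by norm_num) (by
          have : 1 ≤ x ^ 3 := Nat.one_le_pow _ _ (by omega)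
          omega)
    calc h ≤ 4 ^ T * 2 ^ T := Nat.mul_le_mul h₂ h₁.le
      _ = 8 ^ T := by rw [← mul_pow]; norm_num
      _ ≤ N := Nat.pow_le_pow_left (by omega) _
  obtain ⟨f, hf⟩ := exists_pair_coloring (K := F × F) (N := N) (T := T) (h := h) (by omega) hhN
    (by
      rw [hK, hTdef, pow_succ x 3, mul_comm]
      exact Nat.mul_le_mul_left _ (by omega))
    (by
      rw [hK]
      -- The powers of `x` are 7T + 48T on the left and 64T on the right; the spare x^(9T) beats
      -- 2^(16T + 1) because x ≥ 8.
      have e : T ^ h * 2 = 2 ^ (16 * T + 1) * x ^ (3 * h) := by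
        rw [hTdef, mul_pow, ← pow_mul, ← hTdef, pow_succ, hh]; ring
      calc N ^ 3 * (2 * ((x ^ 4) ^ T * T ^ h)) = x ^ (7 * T) * (T ^ h * 2) := by
            rw [hN, ← pow_mul, ← pow_mul]; ring
        _ = 2 ^ (16 * T + 1) * (x ^ (7 * T) * x ^ (3 * h)) := by rw [e]; ring
        _ < x ^ (9 * T) * (x ^ (7 * T) * x ^ (3 * h)) := by
            refine Nat.mul_lt_mul_of_pos_right ?_ (by positivity)
            calc 2 ^ (16 * T + 1) < 2 ^ (3 * (9 * T)) :=
                  Nat.pow_lt_pow_right (by norm_num) (by omega)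
              _ = 8 ^ (9 * T) := by rw [pow_mul]; norm_num
              _ ≤ x ^ (9 * T) := Nat.pow_le_pow_left (by omega) _
        _ = (x ^ 4) ^ h := by
            rw [← pow_add, ← pow_add, ← pow_mul]; congr 1; omega)
  let g : ℕ → ℕ → F × F := fun a b =>
    if hab : a < N ∧ b < N then f ⟨a, hab.1⟩ ⟨b, hab.2⟩ else 0
  have hg : ∀ S₁ S₂ S₃ : Finset ℕ, S₁ ⊆ Finset.range N → S₂ ⊆ Finset.range N →
      S₃ ⊆ Finset.range N → S₁.card = h → S₂.card = h → S₃.card = h →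
      ∃ a ∈ S₁, T ≤ (S₂.image (g a)).card ∧ T ≤ (S₃.image (g a)).card := by
    have pull : ∀ S ⊆ Finset.range N, ∃ S' : Finset (Fin N), S'.card = S.card ∧
        ∀ i, i ∈ S' ↔ (i : ℕ) ∈ S := fun S hS =>
      ⟨S.attachFin fun n hn => Finset.mem_range.1 (hS hn), by simp, by simp⟩
    intro S₁ S₂ S₃ k₁ k₂ k₃ h₁ h₂ h₃
    obtain ⟨S₁', c₁, m₁⟩ := pull S₁ k₁
    obtain ⟨S₂', c₂, m₂⟩ := pull S₂ k₂
    obtain ⟨S₃', c₃, m₃⟩ := pull S₃ k₃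
    obtain ⟨a, ha, ha₂, ha₃⟩ := hf S₁' S₂' S₃' (c₁.trans h₁) (c₂.trans h₂) (c₃.trans h₃)
    have key : ∀ (S : Finset ℕ) (S' : Finset (Fin N)), (∀ i, i ∈ S' ↔ (i : ℕ) ∈ S) →
        S'.image (f a) ⊆ S.image (g a) := by
      intro S S' hS y hy
      obtain ⟨i, hi, rfl⟩ := Finset.mem_image.1 hy
      exact Finset.mem_image.2 ⟨i, (hS i).1 hi, by simp [g]⟩
    exact ⟨a, (m₁ a).1 ha, ha₂.trans (Finset.card_le_card (key _ _ m₂)),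
      ha₃.trans (Finset.card_le_card (key _ _ m₃))⟩
  refine ⟨fun e => ParabolaArc (g (enum e 0) (enum e 1)) (g (enum e 0) (enum e 2)),
    fun S hS hSc => ?_, fun S hS hSc => ?_⟩
  · by_contra! hred
    have hw := enum_isAscending hSc
    set w := enum S with hwdef
    have harc : ∀ i j, 0 < i → i < j → j ≤ 3 → ParabolaArc (g (w 0) (w i)) (g (w 0) (w j)) := by
      intro i j hi hij hj
      have l₁ := hw.lt hi (by omega)
      have l₂ := hw.lt hij hj
      have hsub : ({w 0, w i, w j} : Finset ℕ) ⊆ S := by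
        simp only [Finset.insert_subset_iff, Finset.singleton_subset_iff]
        exact ⟨enum_mem (by omega), enum_mem (by omega), enum_mem (by omega)⟩
      have h := hred _ hsub (Finset.card_eq_three.2
        ⟨_, _, _, l₁.ne, (l₁.trans l₂).ne, l₂.ne, rfl⟩)
      obtain ⟨e₀, e₁, e₂⟩ := enum_triple l₁ l₂
      rwa [e₀, e₁, e₂] at h
    exact (harc 1 2 (by omega) (by omega) (by omega)).not_transitive h2
      (harc 2 3 (by omega) (by omega) (by omega)) (harc 1 3 (by omega) (by omega) (by omega))
  · obtain ⟨m, hm⟩ : ∃ m, h = m + 1 := ⟨h - 1, by omega⟩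
    have hSc' : S.card = 3 * m + 2 + 1 := by omega
    have hw := enum_isAscending hSc'
    set w := enum S with hwdef
    have hblock : ∀ i, i < 3 → ((Finset.range h).image fun t => w (i * h + t)) ⊆ S ∧
        ((Finset.range h).image fun t => w (i * h + t)).card = h := by
      intro i hi
      refine ⟨fun y hy => ?_, ?_⟩
      · obtain ⟨t, ht, rfl⟩ := Finset.mem_image.1 hy
        have := Finset.mem_range.1 ht
        exact enum_mem (by interval_cases i <;> omega)
      · have h₁ := (hw.shift (a := i * h) (b := m) (by interval_cases i <;> omega)).card_image
        rwa [← hm] at h₁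
    obtain ⟨a, ha, ha₂, ha₃⟩ := hg _ _ _ ((hblock 0 (by omega)).1.trans hS)
      ((hblock 1 (by omega)).1.trans hS) ((hblock 2 (by omega)).1.trans hS)
      (hblock 0 (by omega)).2 (hblock 1 (by omega)).2 (hblock 2 (by omega)).2
    by_contra! hblue
    have hle := card_mul_card_le_of_no_arc h2 (Finset.image (g a) _) (Finset.image (g a) _) (fun y hy z hz hyz => by
      obtain ⟨b, hb, rfl⟩ := Finset.mem_image.1 hy
      obtain ⟨c, hc, rfl⟩ := Finset.mem_image.1 hz
      have haS := (hblock 0 (by omega)).1 ha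
      have hbS := (hblock 1 (by omega)).1 hb
      have hcS := (hblock 2 (by omega)).1 hc
      obtain ⟨i, hi, rfl⟩ := Finset.mem_image.1 ha
      obtain ⟨j, hj, rfl⟩ := Finset.mem_image.1 hb
      obtain ⟨l, hl, rfl⟩ := Finset.mem_image.1 hc
      simp only [Finset.mem_range] at hi hj hl
      have l₁ := hw.lt (i := 0 * h + i) (j := 1 * h + j) (by omega) (by omega)
      have l₂ := hw.lt (i := 1 * h + j) (j := 2 * h + l) (by omega) (by omega)
      obtain ⟨e₀, e₁, e₂⟩ := enum_triple l₁ l₂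
      refine hblue {w (0 * h + i), w (1 * h + j), w (2 * h + l)} ?_ ?_ ?_
      · simp only [Finset.insert_subset_iff, Finset.singleton_subset_iff]
        exact ⟨haS, hbS, hcS⟩
      · exact Finset.card_eq_three.2 ⟨_, _, _, l₁.ne, (l₁.trans l₂).ne, l₂.ne, rfl⟩
      · rw [e₀, e₁, e₂]; exact hyz)
    rw [hF] at hle
    generalize (Finset.image (g a) _).card = A at *
    generalize (Finset.image (g a) _).card = B at *
    rw [hTdef] at ha₂ ha₃
    -- With q = x² the arc bound reads (A - 2x²)B ≤ x⁶, but A, B ≥ 2x³ and x ≥ 9 make the left side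
    -- at least 2x⁶.
    have h₁ : 2 * x ^ 3 ≥ 18 * x ^ 2 := by rw [pow_succ x 2]; nlinarith [sq_nonneg x]
    have h₂ : x ^ 3 ≤ A - 2 * x ^ 2 := by omega
    have h₃ : (A - 2 * x ^ 2) * B ≤ (x ^ 2) ^ 3 := by
      rw [Nat.sub_mul]; omega
    have h₄ := (Nat.mul_le_mul h₂ ha₃).trans h₃
    have h₅ : 0 < x ^ 6 := by positivity
    have h₆ : x ^ 3 * (2 * x ^ 3) = 2 * x ^ 6 := by ring
    have h₇ : (x ^ 2) ^ 3 = x ^ 6 := by ring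
    omega

/-- The field of order 9^j has odd characteristic and square order, so that q^(3/2) is the integer
27^j. -/
theorem avoidsCliques_three_four {j : ℕ} (hj : 2 ≤ j) :
    AvoidsCliques 3 4 (96 * (3 ^ j) ^ 3) ((3 ^ j) ^ (2 * (3 ^ j) ^ 3)) := by
  have : Fact (Nat.Prime 3) := ⟨Nat.prime_three⟩
  have := Fintype.ofFinite (GaloisField 3 (2 * j))
  refine avoidsCliques_three_four_of_field (F := GaloisField 3 (2 * j)) ?_ ?_ ?_
  · intro h
    have h₁ : ((2 : ℕ) : GaloisField 3 (2 * j)) = 0 := by exact_mod_cast h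
    rw [CharP.cast_eq_zero_iff (GaloisField 3 (2 * j)) 3] at h₁
    omega
  · calc 9 = 3 ^ 2 := rfl
      _ ≤ 3 ^ j := Nat.pow_le_pow_right (by norm_num) hj
  · rw [Fintype.card_eq_nat_card, GaloisField.card 3 (2 * j) (by omega), ← pow_mul, mul_comm]

/-! ### Iteration and asymptotics -/

/-- Only the first step is exponential in `n`; the linear loss of every later one goes into the
additive constant `b` of the exponent. -/
theorem exists_avoidsCliques_tower (i : ℕ) : ∃ b : ℕ, ∀ n M : ℕ, 0 < M → AvoidsCliques 3 4 n M →
    AvoidsCliques (4 + i) (4 + i + 1) (2 ^ (2 * n + b)) ((fun m => 2 ^ m)^[i + 1] M) := by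
  induction i with
  | zero => exact ⟨0, fun n M hM h => h.four_five hM⟩
  | succ i ih =>
    obtain ⟨b, hb⟩ := ih
    refine ⟨b + (i + 7), fun n M hM h => ?_⟩
    rw [Function.iterate_succ_apply']
    refine ((hb n M hM h).succ (by omega) ?_).mono ?_
    · rw [Function.iterate_succ_apply']; positivity
    · have h₁ : i + 5 < 2 ^ (i + 5) := Nat.lt_two_pow_self
      have h₂ : 1 ≤ 2 ^ (2 * n + b) := Nat.one_le_two_pow
      have h₃ : 2 ^ (2 * n + (b + (i + 7))) = 4 * (2 ^ (2 * n + b) * 2 ^ (i + 5)) := by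
        rw [← add_assoc, pow_add, show i + 7 = i + 5 + 2 by omega, pow_add 2 (i + 5)]; ring
      rw [h₃]
      nlinarith [Nat.mul_le_mul h₂ h₁.le]

theorem cast_iterate_two_pow (i M : ℕ) :
    (((fun m => 2 ^ m)^[i] M : ℕ) : ℝ) = twr (i + 1) M := by
  induction i with
  | zero => rfl
  | succ i ih =>
    rw [Function.iterate_succ_apply', twr, ← ih, Real.rpow_natCast]
    push_cast
    rfl

theorem twr_mono (i : ℕ) : Monotone (twr (i + 1)) := by
  induction i with
  | zero => exact fun x y h => h
  | succ i ih => exact fun x y h => Real.rpow_le_rpow_of_exponent_le one_le_two (ih h)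

/-- If `log n` is at most a constant times `27 ^ j`, then `n ^ (c log log n) ≤ 3 ^ (2 j 27 ^ j)`. -/
theorem rpow_log_log_le {n j : ℕ} (hj : 13 ≤ j) (hn1 : 1 < n)
    (hn : n < 2 ^ (193 * 27 ^ (j + 1))) :
    (n : ℝ) ^ ((1 / 15633 : ℝ) * Real.logb 2 (Real.logb 2 (n : ℝ))) ≤
      (((3 ^ j) ^ (2 * (3 ^ j) ^ 3) : ℕ) : ℝ) := by
  have hn0 : (0 : ℝ) < n := by exact_mod_cast (zero_lt_one.trans hn1)
  have hL : 0 < Real.logb 2 n := Real.logb_pos one_lt_two (by exact_mod_cast hn1)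
  set L := Real.logb 2 (n : ℝ) with hLdef
  have hLle : L ≤ 5211 * 27 ^ j := by
    have h₁ : (n : ℝ) ≤ (2 : ℝ) ^ (193 * 27 ^ (j + 1)) := by exact_mod_cast hn.le
    have h₂ := Real.logb_le_logb_of_le one_lt_two hn0 h₁
    rw [Real.logb_pow, Real.logb_self_eq_one one_lt_two] at h₂
    refine h₂.trans (le_of_eq ?_)
    push_cast
    ring
  -- Uses 5211 ≤ 2^13 and 27 ≤ 2^5, then 13 ≤ j.
  have hLL : Real.logb 2 L ≤ 6 * j := by
    have h₁ : L ≤ (2 : ℝ) ^ (13 + 5 * j) := by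
      refine hLle.trans ?_
      rw [pow_add, pow_mul]
      gcongr <;> norm_num
    have h₂ := Real.logb_le_logb_of_le one_lt_two hL h₁
    rw [Real.logb_pow, Real.logb_self_eq_one one_lt_two] at h₂
    have h₃ : (13 : ℝ) ≤ j := by exact_mod_cast hj
    push_cast at h₂
    linarith
  -- The constant is 15633 = 3 · 5211, so that 5211 · 6j / 15633 = 2j.
  have hexp : L * (1 / 15633 * Real.logb 2 L) ≤ ((2 * j * 27 ^ j : ℕ) : ℝ) := by
    have h₁ : L * Real.logb 2 L ≤ 5211 * 27 ^ j * (6 * j) :=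
      (mul_le_mul_of_nonneg_left hLL hL.le).trans (mul_le_mul_of_nonneg_right hLle (by positivity))
    push_cast
    linarith
  calc (n : ℝ) ^ ((1 / 15633 : ℝ) * Real.logb 2 L)
      = (2 : ℝ) ^ (L * (1 / 15633 * Real.logb 2 L)) := by
        rw [Real.rpow_mul zero_le_two, Real.rpow_logb zero_lt_two (by norm_num) hn0]
    _ ≤ (2 : ℝ) ^ ((2 * j * 27 ^ j : ℕ) : ℝ) :=
        Real.rpow_le_rpow_of_exponent_le one_le_two hexp
    _ = (2 : ℝ) ^ (2 * j * 27 ^ j) := Real.rpow_natCast _ _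
    _ ≤ (3 : ℝ) ^ (2 * j * 27 ^ j) := by gcongr; norm_num
    _ = _ := by
        push_cast
        rw [← pow_mul, ← pow_mul, mul_comm j 3, pow_mul 3 3 j]
        norm_num
        ring

theorem twr_lt_hypergraphRamsey (i : ℕ) : ∃ n₀ : ℕ, ∀ n : ℕ, n₀ ≤ n →
    (hypergraphRamsey (4 + i) (4 + i + 1) n : ℝ) >
      twr (i + 2) ((n : ℝ) ^ ((1 / 15633 : ℝ) * Real.logb 2 (Real.logb 2 (n : ℝ)))) := by
  obtain ⟨b, hb⟩ := exists_avoidsCliques_tower i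
  -- The colorings need n ≥ 2^(192 · 27^j + b), and 193 · 27^j covers this exponent once b ≤ 27^j.
  -- The threshold forces j ≥ b + 13.
  refine ⟨2 ^ (193 * 27 ^ (b + 13)), fun n hn => ?_⟩
  have hex : ∃ j, n < 2 ^ (193 * 27 ^ (j + 1)) := by
    refine ⟨n, Nat.lt_two_pow_self.trans_le (Nat.pow_le_pow_right (by norm_num) ?_)⟩
    have h : n + 1 < 27 ^ (n + 1) := Nat.lt_pow_self (by norm_num)
    omega
  classical
  obtain ⟨j, hj, hmin⟩ : ∃ j, n < 2 ^ (193 * 27 ^ (j + 1)) ∧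
      ∀ m < j, ¬ n < 2 ^ (193 * 27 ^ (m + 1)) :=
    ⟨Nat.find hex, Nat.find_spec hex, fun m hm => Nat.find_min hex hm⟩
  have hbj : b + 13 ≤ j := by
    by_contra! hlt
    refine absurd hj (not_lt.2 (le_trans ?_ hn))
    exact Nat.pow_le_pow_right (by norm_num)
      (Nat.mul_le_mul_left _ (Nat.pow_le_pow_right (by norm_num) (by omega)))
  have hjn : 2 ^ (193 * 27 ^ j) ≤ n := by
    have h := not_lt.1 (hmin (j - 1) (by omega))
    rwa [Nat.sub_add_cancel (by omega)] at h
  have h27 : j < 27 ^ j := Nat.lt_pow_self (by norm_num)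
  have hn1 : 1 < n := (Nat.one_lt_two_pow (by omega)).trans_le hjn
  have havoid := ((hb _ _ (by positivity) (avoidsCliques_three_four (j := j) (by omega))).mono
    (n' := n) (le_trans (Nat.pow_le_pow_right (by norm_num) (by
      rw [← pow_mul, mul_comm j 3, pow_mul]
      norm_num
      omega)) hjn)).lt_hypergraphRamsey
  refine lt_of_le_of_lt (twr_mono (i + 1) (rpow_log_log_le (by omega) hn1 hj)) ?_
  rw [← cast_iterate_two_pow]
  exact_mod_cast havoid

theorem mainTheorem1 :
    ∃ c : ℝ, 0 < c ∧
      (∃ n₀ : ℕ, ∀ n : ℕ, n₀ ≤ n →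
        (hypergraphRamsey 4 5 n : ℝ) >
          (2 : ℝ) ^ ((n : ℝ) ^ (c * Real.logb 2 (Real.logb 2 (n : ℝ))))) ∧
      (∀ k : ℕ, 4 < k → ∃ n₀ : ℕ, ∀ n : ℕ, n₀ ≤ n →
        (hypergraphRamsey k (k + 1) n : ℝ) >
          twr (k - 2) ((n : ℝ) ^ (c * Real.logb 2 (Real.logb 2 (n : ℝ))))) := by
  refine ⟨1 / 15633, by norm_num, twr_lt_hypergraphRamsey 0, fun k hk => ?_⟩
  obtain ⟨i, rfl⟩ := Nat.exists_eq_add_of_le hk.le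
  rw [show 4 + i - 2 = i + 2 by omega]
  exact twr_lt_hypergraphRamsey i
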